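/- Let $\nu$ be a $\sigma$-finite measure and $f_0,f_1$ two probability densities with respect to $\nu$ whose Kullback–Leibler divergences are positive and finite: $$I_0=\int \log\frac{f_0}{f_1}\,f_0\,d\nu\in(0,\infty),\qquad I_1=\int \log\frac{f_1}{f_0}\,f_1\,d\nu\in(0,\infty).$$ For $i\in\{0,1\}$ let $\mathsf P_i$ (with expectation $\mathsf E_i$) be the distribution of an i.i.d. sequence $X=(X_n)_{n\ge 1}$ with density $f_i$, let $\mathsf P_\pi=(1-\pi)\mathsf P_0+\pi\mathsf P_1$ (with expectation $\mathsf E_\pi$) for $\pi\in[0,1]$, and set $\mathcal F_n=\sigma(X_1,\dots,X_n)$ and $\Lambda_n=\sum_{i=1}^n\log\frac{f_1(X_i)}{f_0(X_i)}$. A test is a pair $(T,D)$ of functions of $X$, where $T\in\{1,2,\dots\}\cup\{\infty\}$ and $D$ is a $\{0,1\}$-valued random variable, such that $\{T=n\}\in\mathcal F_n$ and $\{T=n,\,D=i\}\in\mathcal F_n$ for all $n\ge 1$ and $i\in\{0,1\}$. For $\alpha,\beta\in(0,1)$ let $\mathcal E(\alpha,\beta)$ be the class of tests with $\mathsf P_0(D=1)\le\alpha$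 and $\mathsf P_1(D=0)\le\beta$, and let $\mathcal L_\pi(\alpha,\beta)=\inf_{(T,D)\in\mathcal E(\alpha,\beta)}\mathsf E_\pi[T]$. The sequential probability ratio test (SPRT) has stopping time $$\widetilde T(\alpha,\beta)=\inf\{n\ge 1:\Lambda_n\notin(-|\log\beta|,\,|\log\alpha|)\}$$ and decision $\widetilde D(\alpha,\beta)=1\{\Lambda_{\widetilde T(\alpha,\beta)}\ge|\log\alpha|\}$. For every integer $m\ge 1$ let $l_m,u_m$ be integers with $0\le l_m\le u_m\le m$, $u_m>0$ and $l_m<m$, and for $\alpha,\beta\in(0,1)$ put $$\alpha_m=1-(1-\alpha)^{1/(m-l_m)},\qquad \beta_m=1-(1-\beta)^{1/u_m}.$$ Let $\chi^*=\{(T^*(\alpha,\beta),D^*(\alpha,\beta))\in\mathcal E(\alpha,\beta):\ \alpha,\beta\in(0,1)\}$ be a family of tests that is asymptotically optimal in the high-dimensional sense, i.e. for all $\alpha,\beta\in(0,1)$, $$\max_{s\in\{l_m,\dots,u_m\}}\frac{\mathsf E_{s/m}[T^*(\alpha_m,\beta_m)]}{\mathcal L_{s/m}(\alpha_m,\beta_m)}\longrightarrow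 1\qquad(m\to\infty).$$ Write $x_k\lesssim y_k$ for $\limsup_{k\to\infty}(x_k/y_k)\le 1$. Then: (i) If $u_m\not\to\infty$ as $m\to\infty$, there exists a strictly increasing sequence of positive integers $(m_k)$ such that, as $k\to\infty$, $$\mathsf E_0[T^*(\alpha_{m_k},\beta)]\lesssim\mathsf E_0[\widetilde T(\alpha_{m_k},\beta)]\qquad\text{for all }\alpha,\beta\in(0,1).$$ (ii) If $m-l_m\not\to\infty$ as $m\to\infty$, there exists a strictly increasing sequence of positive integers $(m_k)$ such that, as $k\to\infty$, $$\mathsf E_1[T^*(\alpha,\beta_{m_k})]\lesssim\mathsf E_1[\widetilde T(\alpha,\beta_{m_k})]\qquad\text{for all }\alpha,\beta\in(0,1).$$ -/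

import Mathlib

open MeasureTheory Filter Topology
open scoped ENNReal

namespace SharpSPRT

noncomputable section

/-- A pair `(T, D)`: a random time, possibly infinite, and a binary decision, both functions of the
sequence of observations; `D = true` means that the null hypothesis is rejected. -/
abbrev TimeDecision (S : Type*) : Type _ := ((ℕ → S) → ℕ∞) × ((ℕ → S) → Bool)

variable {S : Type*} [MeasurableSpace S]

/-- The distribution of one observation with density `f` with respect to `ν`. -/
def obsLaw (ν : Measure S) (f : S → ℝ) : Measure S :=
  ν.withDensity (fun x => ENNReal.ofReal (f x))

/-- The distribution `P` of an iid sequence of observations with density `f`.  The coordinates of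
`x : ℕ → S` are numbered from `0`: the observation `X_{i+1}` of the sequence is `x i`. -/
def streamLaw (ν : Measure S) (f : S → ℝ) : Measure (ℕ → S) :=
  Measure.infinitePi (fun _ : ℕ => obsLaw ν f)

/-- `f` is a probability density with respect to `ν`. -/
structure IsDensity (ν : Measure S) (f : S → ℝ) : Prop where
  measurable : Measurable f
  nonneg : ∀ x, 0 ≤ f x
  lintegral_eq_one : ∫⁻ x, ENNReal.ofReal (f x) ∂ν = 1

/-- The Kullback-Leibler divergence `∫ log (f / g) f dν` of the density `f` from the density `g`,
with value in `[0, ∞]`. -/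
def klInfo (ν : Measure S) (f g : S → ℝ) : ℝ≥0∞ :=
  InformationTheory.klDiv (obsLaw ν f) (obsLaw ν g)

variable (S) in
/-- The σ-algebra `F_n` generated by the first `n` observations. -/
@[reducible]
def obsSigma (n : ℕ) : MeasurableSpace (ℕ → S) :=
  ⨆ i ∈ Finset.range n, MeasurableSpace.comap (fun x : ℕ → S => x i) inferInstance

/-- The log-likelihood ratio `Λ_n` of the first `n` observations.  (When the divergences between
`f₀` and `f₁` are finite, the points where `f₀` or `f₁` vanishes have probability zero under both
hypotheses.) -/
def logLR (f₀ f₁ : S → ℝ) (n : ℕ) (x : ℕ → S) : ℝ :=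
  ∑ i ∈ Finset.range n, Real.log (f₁ (x i) / f₀ (x i))

/-- `(T, D)` is a sequential test: `T ≥ 1` is a stopping time and `D` is an `F_T`-measurable
Bernoulli random variable. -/
structure IsTest (τ : TimeDecision S) : Prop where
  one_le : ∀ x, 1 ≤ τ.1 x
  stopping : ∀ n : ℕ, 1 ≤ n → MeasurableSet[obsSigma S n] {x | τ.1 x = n}
  measurable_decision : Measurable τ.2
  decision : ∀ n : ℕ, 1 ≤ n → ∀ i : Bool,
    MeasurableSet[obsSigma S n] {x | τ.1 x = n ∧ τ.2 x = i}

/-- The expectation of the sample size `T` of `(T, D)` under `P`, with value in `[0, ∞]`. -/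
def meanTime (P : Measure (ℕ → S)) (τ : TimeDecision S) : ℝ≥0∞ :=
  ∫⁻ x, (τ.1 x : ℝ≥0∞) ∂P

/-- The class `E(α, β)` of tests with type-I error probability at most `α` and type-II error
probability at most `β`. -/
def testClass (ν : Measure S) (f₀ f₁ : S → ℝ) (α β : ℝ) : Set (TimeDecision S) :=
  {τ | IsTest τ ∧ streamLaw ν f₀ {x | τ.2 x = true} ≤ ENNReal.ofReal α ∧
    streamLaw ν f₁ {x | τ.2 x = false} ≤ ENNReal.ofReal β}

/-- The mixture distribution `P_π = (1 - π) P_0 + π P_1`, for `π ∈ [0, 1]`. -/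
def mixLaw (ν : Measure S) (f₀ f₁ : S → ℝ) (π : ℝ) : Measure (ℕ → S) :=
  ENNReal.ofReal (1 - π) • streamLaw ν f₀ + ENNReal.ofReal π • streamLaw ν f₁

/-- The optimal expected sample size `L_π(α, β)` in `E(α, β)` under `P_π`. -/
def optTime (ν : Measure S) (f₀ f₁ : S → ℝ) (π α β : ℝ) : ℝ≥0∞ :=
  ⨅ τ ∈ testClass ν f₀ f₁ α β, meanTime (mixLaw ν f₀ f₁ π) τ

/-- The stopping time `inf {n ≥ 1 : Λ_n ∉ (-B, A)}` of the sequential probability ratio test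
(`∞` if there is no such `n`). -/
def sprtTime (f₀ f₁ : S → ℝ) (A B : ℝ) (x : ℕ → S) : ℕ∞ :=
  ⨅ n ∈ {n : ℕ | 1 ≤ n ∧ logLR f₀ f₁ n x ∉ Set.Ioo (-B) A}, (n : ℕ∞)

open Classical in
/-- The decision `1{Λ_T ≥ A}` of the sequential probability ratio test (`0` if it never stops). -/
def sprtDecision (f₀ f₁ : S → ℝ) (A B : ℝ) (x : ℕ → S) : Bool :=
  decide (sprtTime f₀ f₁ A B x ≠ ⊤ ∧ A ≤ logLR f₀ f₁ (sprtTime f₀ f₁ A B x).toNat x)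

/-- The sequential probability ratio test with thresholds `A = |log α|` and `B = |log β|`. -/
def sprt (f₀ f₁ : S → ℝ) (α β : ℝ) : TimeDecision S :=
  (sprtTime f₀ f₁ |Real.log α| |Real.log β|, sprtDecision f₀ f₁ |Real.log α| |Real.log β|)

/-- A family of tests, one in `E(α, β)` for all `α, β ∈ (0, 1)`. -/
def IsTestFamily (ν : Measure S) (f₀ f₁ : S → ℝ) (χ : ℝ → ℝ → TimeDecision S) : Prop :=
  ∀ α ∈ Set.Ioo (0 : ℝ) 1, ∀ β ∈ Set.Ioo (0 : ℝ) 1, χ α β ∈ testClass ν f₀ f₁ α β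

/-- The level `α_m = 1 - (1 - α)^{1 / (m - l_m)}`. -/
def alphaLevel (l : ℕ → ℕ) (α : ℝ) (m : ℕ) : ℝ :=
  1 - (1 - α) ^ (1 / ((m : ℝ) - (l m : ℝ)))

/-- The level `β_m = 1 - (1 - β)^{1 / u_m}`. -/
def betaLevel (u : ℕ → ℕ) (β : ℝ) (m : ℕ) : ℝ :=
  1 - (1 - β) ^ (1 / (u m : ℝ))

/-- Asymptotic optimality of a family of tests in the high-dimensional sense: for all
`α, β ∈ (0, 1)`, the maximum over `s ∈ {l_m, …, u_m}` of
`E_{s/m}[T*(α_m, β_m)] / L_{s/m}(α_m, β_m)` tends to `1` as `m → ∞`. -/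
def IsAsympOptimalHD (ν : Measure S) (f₀ f₁ : S → ℝ) (l u : ℕ → ℕ)
    (χ : ℝ → ℝ → TimeDecision S) : Prop :=
  ∀ α ∈ Set.Ioo (0 : ℝ) 1, ∀ β ∈ Set.Ioo (0 : ℝ) 1,
    Tendsto (fun m : ℕ => ⨆ s ∈ Finset.Icc (l m) (u m),
      meanTime (mixLaw ν f₀ f₁ ((s : ℝ) / (m : ℝ))) (χ (alphaLevel l α m) (betaLevel u β m)) /
        optTime ν f₀ f₁ ((s : ℝ) / (m : ℝ)) (alphaLevel l α m) (betaLevel u β m))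
      atTop (𝓝 1)

/-- `x_k ≲ y_k`, i.e. `limsup (x_k / y_k) ≤ 1`. -/
def AsympLE (x y : ℕ → ℝ≥0∞) : Prop :=
  limsup (fun k => x k / y k) atTop ≤ 1

end

end SharpSPRT

/-! If `u` does not tend to infinity, it equals some constant `v` along a subsequence. There the
type-II level can be held at any prescribed `β`, and `s = v` puts weight `v / m`, tending to 0, on
`P₁`. The SPRT competes in the infimum defining the optimal time, so asymptotic optimality bounds
the mixed mean of the given test by a factor tending to 1 times that of the SPRT. On the left the
`P₁` term is dropped; on the right it has to vanish.

A crude bound suffices for that: by a Chernoff bound with exponent 1/2, the `P₁`-mean of the SPRT is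
at most a constant times `√(1/α_m)` (`meanTime_sprt_right_le`), and `α_m ≥ α / m` by Bernoulli, so
the term is of order `m^(-1/2)`. Since sample sizes are at least 1, this additive error becomes a
factor tending to 1 (`asympLE_of_mix`). Part (ii) is the mirror image with `s = l m`.

The SPRT is admissible by Wald's change of measure (`sprt_mem_testClass`). -/

namespace SharpSPRT

/-- `f` and `g` are densities of two distinct, mutually absolutely continuous distributions. -/
structure AreEquivDensities {S : Type*} [MeasurableSpace S] (ν : Measure S) (f g : S → ℝ) :
    Prop where
  left : IsDensity ν f
  right : IsDensity ν g
  ac : obsLaw ν f ≪ obsLaw ν g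
  ac' : obsLaw ν g ≪ obsLaw ν f
  ne : obsLaw ν f ≠ obsLaw ν g

/-- The likelihood ratio `f / g` of one observation. -/
noncomputable def obsRatio {S : Type*} (f g : S → ℝ) (x : S) : ℝ≥0∞ :=
  ENNReal.ofReal (Real.exp (-Real.log (g x / f x)))

theorem prod_obsRatio {S : Type*} (f g : S → ℝ) (n : ℕ) (x : ℕ → S) :
    ∏ i ∈ Finset.range n, obsRatio f g (x i) =
      ENNReal.ofReal (Real.exp (-logLR f g n x)) := by
  unfold obsRatio logLR
  rw [← Finset.sum_neg_distrib, Real.exp_sum,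
    ENNReal.ofReal_prod_of_nonneg fun i _ => (Real.exp_pos _).le]

/-! ### Likelihood ratios, Hellinger affinity and change of measure -/

section

variable {S : Type*} [MeasurableSpace S] {ν : Measure S} {f g : S → ℝ}

theorem IsDensity.isProbabilityMeasure (hf : IsDensity ν f) :
    IsProbabilityMeasure (obsLaw ν f) :=
  ⟨by rw [obsLaw, withDensity_apply _ MeasurableSet.univ, setLIntegral_univ,
    hf.lintegral_eq_one]⟩

theorem IsDensity.isProbabilityMeasure_streamLaw (hf : IsDensity ν f) :
    IsProbabilityMeasure (streamLaw ν f) := by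
  have := hf.isProbabilityMeasure
  unfold streamLaw
  infer_instance

/-- A finite divergence forces absolute continuity, and a positive one excludes equal laws. The rest
of the argument needs no more about the divergences. -/
theorem areEquivDensities_of_klInfo (hf : IsDensity ν f) (hg : IsDensity ν g)
    (h : klInfo ν f g ∈ Set.Ioo (0 : ℝ≥0∞) ⊤) (h' : klInfo ν g f ∈ Set.Ioo (0 : ℝ≥0∞) ⊤) :
    AreEquivDensities ν f g where
  left := hf
  right := hg
  ac := (InformationTheory.klDiv_ne_top_iff.1 h.2.ne).1
  ac' := (InformationTheory.klDiv_ne_top_iff.1 h'.2.ne).1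
  ne := by
    intro heq
    have := hg.isProbabilityMeasure
    have h0 := h.1
    rw [klInfo, heq, InformationTheory.klDiv_self] at h0
    exact lt_irrefl _ h0

theorem AreEquivDensities.symm (h : AreEquivDensities ν f g) : AreEquivDensities ν g f :=
  ⟨h.right, h.left, h.ac', h.ac, h.ne.symm⟩

theorem IsDensity.ae_eq_zero_of_ac (hf : IsDensity ν f) (hg : IsDensity ν g)
    (h : obsLaw ν f ≪ obsLaw ν g) : ∀ᵐ x ∂ν, g x = 0 → f x = 0 := by
  have hm : Measurable fun x => ENNReal.ofReal (g x) := hg.measurable.ennreal_ofReal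
  have h0 : ∀ᵐ x ∂(obsLaw ν g), g x ≠ 0 := by
    rw [obsLaw, ae_withDensity_iff hm]
    filter_upwards with x hx h0
    simp [h0] at hx
  have h1 : ∀ᵐ x ∂(obsLaw ν f), g x ≠ 0 := h.ae_le h0
  rw [obsLaw, ae_withDensity_iff hf.measurable.ennreal_ofReal] at h1
  filter_upwards [h1] with x hx hgx
  by_contra hfx
  exact hx (by simpa using lt_of_le_of_ne (hf.nonneg x) (Ne.symm hfx)) hgx

theorem measurable_obsRatio (hf : Measurable f) (hg : Measurable g) :
    Measurable (obsRatio f g) := by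
  unfold obsRatio
  fun_prop

/-- Where `f` or `g` vanishes, `obsRatio` is 1 because `Real.log 0 = 0`. This is harmless: almost
everywhere `f` and `g` vanish together. -/
theorem AreEquivDensities.obsLaw_eq_withDensity (h : AreEquivDensities ν f g) :
    obsLaw ν f = (obsLaw ν g).withDensity (obsRatio f g) := by
  rw [obsLaw, obsLaw, ← withDensity_mul _ h.right.measurable.ennreal_ofReal
    (measurable_obsRatio h.left.measurable h.right.measurable)]
  refine withDensity_congr_ae ?_
  filter_upwards [h.left.ae_eq_zero_of_ac h.right h.ac,
    h.right.ae_eq_zero_of_ac h.left h.ac'] with x hx hx'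
  rw [Pi.mul_apply, obsRatio, ← ENNReal.ofReal_mul (h.right.nonneg x)]
  congr 1
  by_cases hg : g x = 0
  · simp [hg, hx hg]
  · have hf : f x ≠ 0 := fun hf => hg (hx' hf)
    have hg' := lt_of_le_of_ne (h.right.nonneg x) (Ne.symm hg)
    have hf' := lt_of_le_of_ne (h.left.nonneg x) (Ne.symm hf)
    rw [Real.exp_neg, Real.exp_log (by positivity)]
    field_simp

variable (ν f g) in
/-- The Hellinger affinity `∫ √(f g) dν`. -/
noncomputable def affinity : ℝ≥0∞ :=
  ∫⁻ x, ENNReal.ofReal (Real.exp (-Real.log (g x / f x) / 2)) ∂(obsLaw ν g)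

/-- AM-GM, `t ≤ (1 + t²) / 2` with `t = √(f / g)`: the right side integrates to 1, and equality of
the integrals forces `t = 1` almost everywhere, hence equal laws. -/
theorem AreEquivDensities.affinity_lt_one (h : AreEquivDensities ν f g) :
    affinity ν f g < 1 := by
  have := h.left.isProbabilityMeasure
  have := h.right.isProbabilityMeasure
  have hfm := h.left.measurable
  have hgm := h.right.measurable
  have hsq : ∀ x, Real.exp (-Real.log (g x / f x)) =
      Real.exp (-Real.log (g x / f x) / 2) ^ 2 := fun x => by
    rw [← Real.exp_nat_mul]
    congr 1
    push_cast
    ring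
  have hle : ∀ x, ENNReal.ofReal (Real.exp (-Real.log (g x / f x) / 2)) ≤
      2⁻¹ * (1 + obsRatio f g x) := fun x => by
    rw [obsRatio, ← ENNReal.ofReal_one, ← ENNReal.ofReal_add zero_le_one (Real.exp_pos _).le,
      show (2⁻¹ : ℝ≥0∞) = ENNReal.ofReal 2⁻¹ by
        rw [ENNReal.ofReal_inv_of_pos two_pos, ENNReal.ofReal_ofNat],
      ← ENNReal.ofReal_mul (by norm_num)]
    refine ENNReal.ofReal_le_ofReal ?_
    rw [hsq]
    nlinarith [sq_nonneg (Real.exp (-Real.log (g x / f x) / 2) - 1)]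
  have hone : ∫⁻ x, 2⁻¹ * (1 + obsRatio f g x) ∂(obsLaw ν g) = 1 := by
    have hrm := measurable_obsRatio hfm hgm
    have hr : ∫⁻ x, obsRatio f g x ∂(obsLaw ν g) = 1 := by
      rw [← setLIntegral_univ, ← withDensity_apply _ MeasurableSet.univ,
        ← h.obsLaw_eq_withDensity, measure_univ]
    rw [lintegral_const_mul _ (by fun_prop),
      lintegral_add_left measurable_const, hr, lintegral_const, measure_univ, mul_one,
      one_add_one_eq_two, ENNReal.inv_mul_cancel two_ne_zero ENNReal.ofNat_ne_top]
  have hle' : affinity ν f g ≤ 1 := hone ▸ lintegral_mono hle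
  refine lt_of_le_of_ne hle' fun heq => h.ne ?_
  have hae := ae_eq_of_ae_le_of_lintegral_le (μ := obsLaw ν g) (Eventually.of_forall hle)
    (by change affinity ν f g ≠ ⊤; simp [heq])
    (measurable_const.mul (measurable_const.add (measurable_obsRatio hfm hgm))).aemeasurable
    (by rw [hone]; exact heq.ge)
  rw [h.obsLaw_eq_withDensity]
  conv_rhs => rw [← withDensity_one (μ := obsLaw ν g)]
  refine withDensity_congr_ae ?_
  filter_upwards [hae] with x hx
  rw [obsRatio, ← ENNReal.ofReal_one, ← ENNReal.ofReal_add zero_le_one (Real.exp_pos _).le,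
      show (2⁻¹ : ℝ≥0∞) = ENNReal.ofReal 2⁻¹ by
        rw [ENNReal.ofReal_inv_of_pos two_pos, ENNReal.ofReal_ofNat],
      ← ENNReal.ofReal_mul (by norm_num),
      ENNReal.ofReal_eq_ofReal_iff (by positivity) (by positivity), hsq] at hx
  have h1 : Real.exp (-Real.log (g x / f x) / 2) = 1 := by
    nlinarith [sq_nonneg (Real.exp (-Real.log (g x / f x) / 2) - 1)]
  rw [obsRatio, hsq, h1]
  simp

theorem lintegral_prod_streamLaw (hg : IsDensity ν g) (n : ℕ) (r : ℕ → S → ℝ≥0∞)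
    (hr : ∀ i, Measurable (r i)) :
    ∫⁻ x, ∏ i ∈ Finset.range n, r i (x i) ∂(streamLaw ν g) =
      ∏ i ∈ Finset.range n, ∫⁻ y, r i y ∂(obsLaw ν g) := by
  have := hg.isProbabilityMeasure
  rw [streamLaw, ProbabilityTheory.lintegral_prod_eq_prod_lintegral_of_indepFun
    (Finset.range n) (fun i (x : ℕ → S) => r i (x i))
    (ProbabilityTheory.iIndepFun_infinitePi hr)
    (fun i => (hr i).comp (measurable_pi_apply i))]
  refine Finset.prod_congr rfl fun i _ => ?_
  rw [← lintegral_map (hr i) (measurable_pi_apply i),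
    Measure.infinitePi_map_eval (fun _ : ℕ => obsLaw ν g) i]

theorem obsSigma_le_comap_restrict (n : ℕ) :
    obsSigma S n ≤ MeasurableSpace.comap ((Finset.range n).restrict (π := fun _ => S))
      MeasurableSpace.pi := by
  refine iSup₂_le fun i hi => ?_
  rw [MeasurableSpace.comap_le_iff_le_map]
  intro s hs
  exact ⟨(fun y : (j : Finset.range n) → S => y ⟨i, hi⟩) ⁻¹' s,
    (measurable_pi_apply _) hs, rfl⟩

theorem obsSigma_le (n : ℕ) : obsSigma S n ≤ MeasurableSpace.pi :=
  iSup₂_le fun i _ => (measurable_pi_apply i).comap_le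

/-- An event of `obsSigma S n` depends on the first `n` coordinates only, so it is enough to compare
the two marginals there, and on boxes both factor. -/
theorem streamLaw_eq_setLIntegral (h : AreEquivDensities ν f g) (n : ℕ) {E : Set (ℕ → S)}
    (hE : MeasurableSet[obsSigma S n] E) :
    streamLaw ν f E =
      ∫⁻ x in E, ∏ i ∈ Finset.range n, obsRatio f g (x i) ∂(streamLaw ν g) := by
  have := h.left.isProbabilityMeasure
  have hrm := measurable_obsRatio h.left.measurable h.right.measurable
  have hmR : Measurable ((Finset.range n).restrict (π := fun _ : ℕ => S)) := by fun_prop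
  have hmap : (streamLaw ν f).map (Finset.range n).restrict =
      ((streamLaw ν g).withDensity
        fun x => ∏ i ∈ Finset.range n, obsRatio f g (x i)).map (Finset.range n).restrict := by
    rw [streamLaw, Measure.infinitePi_map_restrict]
    refine Measure.pi_eq fun s hs => ?_
    classical
    let s' : ℕ → Set S := fun i => if hi : i ∈ Finset.range n then s ⟨i, hi⟩ else Set.univ
    have hs' : ∀ i, MeasurableSet (s' i) := fun i => by
      by_cases hi : i ∈ Finset.range n
      · simpa only [s', dif_pos hi] using hs ⟨i, hi⟩
      · simp only [s', dif_neg hi, MeasurableSet.univ]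
    have hss : ∀ i : Finset.range n, s i = s' i := fun i => by
      simp only [s', dif_pos i.2]
    have hbox : MeasurableSet (Set.univ.pi s) := MeasurableSet.univ_pi hs
    rw [Measure.map_apply hmR hbox, withDensity_apply _ (hmR hbox),
      ← lintegral_indicator (hmR hbox)]
    have hind : ∀ x : ℕ → S,
        ((Finset.range n).restrict ⁻¹' Set.univ.pi s).indicator
          (fun x => ∏ i ∈ Finset.range n, obsRatio f g (x i)) x =
        ∏ i ∈ Finset.range n, (s' i).indicator (obsRatio f g) (x i) := fun x => by
      by_cases hx : ∀ i ∈ Finset.range n, x i ∈ s' i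
      · rw [Set.indicator_of_mem]
        · exact Finset.prod_congr rfl fun i hi => (Set.indicator_of_mem (hx i hi) _).symm
        · intro i _
          rw [hss]
          exact hx i i.2
      · push Not at hx
        obtain ⟨i, hi, hxi⟩ := hx
        rw [Set.indicator_of_notMem, Finset.prod_eq_zero hi (Set.indicator_of_notMem hxi _)]
        intro hmem
        have := hmem ⟨i, hi⟩ (Set.mem_univ _)
        rw [hss] at this
        exact hxi this
    rw [lintegral_congr hind, lintegral_prod_streamLaw h.right n
      (fun i => (s' i).indicator (obsRatio f g)) (fun i => hrm.indicator (hs' i)),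
      ← Finset.prod_coe_sort]
    refine Finset.prod_congr rfl fun i _ => ?_
    rw [lintegral_indicator (hs' i), ← withDensity_apply _ (hs' i),
      ← h.obsLaw_eq_withDensity, hss]
  obtain ⟨E', hE', rfl⟩ := obsSigma_le_comap_restrict n E hE
  rw [← Measure.map_apply hmR hE', hmap, Measure.map_apply hmR hE',
    withDensity_apply _ (hmR hE')]

theorem streamLaw_le_of_le_logLR (h : AreEquivDensities ν f g) (n : ℕ) {E : Set (ℕ → S)}
    (hE : MeasurableSet[obsSigma S n] E) {A : ℝ} (hA : ∀ x ∈ E, A ≤ logLR f g n x) :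
    streamLaw ν f E ≤ ENNReal.ofReal (Real.exp (-A)) * streamLaw ν g E := by
  rw [streamLaw_eq_setLIntegral h n hE, ← setLIntegral_const]
  refine setLIntegral_mono' (obsSigma_le n E hE) fun x hx => ?_
  rw [prod_obsRatio]
  exact ENNReal.ofReal_le_ofReal (Real.exp_le_exp.2 (neg_le_neg (hA x hx)))

theorem measurable_logLR (hf : Measurable f) (hg : Measurable g) {k n : ℕ} (hkn : k ≤ n) :
    Measurable[obsSigma S n] (logLR f g k) := by
  unfold logLR
  have hcoord : ∀ i ∈ Finset.range k, Measurable[obsSigma S n] fun x : ℕ → S => x i :=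
    fun i hi => Measurable.mono (comap_measurable _)
      (le_iSup₂_of_le (f := fun i (_ : i ∈ Finset.range n) =>
        MeasurableSpace.comap (fun x : ℕ → S => x i) inferInstance) i
        (Finset.range_mono hkn hi) le_rfl) le_rfl
  exact Finset.measurable_fun_sum _ fun i hi =>
    (hg.div hf).log.comp (hcoord i hi)

/-- Markov's inequality for `exp (-Λ_n / 2)`, whose mean factors into `n` affinities. -/
theorem streamLaw_logLR_lt_le (h : AreEquivDensities ν f g) (n : ℕ) (A : ℝ) :
    streamLaw ν g {x | logLR f g n x < A} ≤
      ENNReal.ofReal (Real.exp (A / 2)) * affinity ν f g ^ n := by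
  have hfm := h.left.measurable
  have hgm := h.right.measurable
  have hint : ∫⁻ x, ENNReal.ofReal (Real.exp (-logLR f g n x / 2)) ∂(streamLaw ν g) =
      affinity ν f g ^ n := by
    have := lintegral_prod_streamLaw h.right n
      (fun _ y => ENNReal.ofReal (Real.exp (-Real.log (g y / f y) / 2)))
      (fun _ => by fun_prop)
    rw [Finset.prod_const, Finset.card_range] at this
    rw [affinity, ← this]
    refine lintegral_congr fun x => ?_
    rw [logLR, ← Finset.sum_neg_distrib, Finset.sum_div, Real.exp_sum,
      ENNReal.ofReal_prod_of_nonneg fun i _ => (Real.exp_pos _).le]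
  have hm : MeasurableSet {x | logLR f g n x < A} :=
    obsSigma_le n _ (measurable_logLR hfm hgm le_rfl measurableSet_Iio)
  rw [← hint, ← lintegral_const_mul' _ _ ENNReal.ofReal_ne_top, ← lintegral_indicator_one hm]
  refine lintegral_mono (Set.indicator_le fun x hx => ?_)
  rw [← ENNReal.ofReal_mul (Real.exp_pos _).le, ← Real.exp_add, Pi.one_apply,
    ENNReal.one_le_ofReal, Real.one_le_exp_iff]
  have : logLR f g n x < A := hx
  linarith

theorem toENNReal_le_tsum (t : ℕ∞) :
    (t : ℝ≥0∞) ≤ ∑' n : ℕ, Set.indicator {n : ℕ | (n : ℕ∞) < t} 1 n := by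
  rw [← tsum_subtype]
  simp only [Pi.one_apply]
  rw [ENNReal.tsum_set_one]
  refine ENat.toENNReal_le.2 ?_
  induction t using ENat.recTopCoe with
  | top => simp [Set.encard_univ]
  | coe k =>
    have : {n : ℕ | (n : ℕ∞) < k} = Finset.range k := by ext; simp
    rw [this, Set.encard_coe_eq_coe_finsetCard, Finset.card_range]

/-- The tail sum of `T` is dominated pathwise by indicators of `Λ_n < A`, whose probabilities decay
geometrically; `T` itself need not be measurable. -/
theorem lintegral_le_of_logLR_lt (h : AreEquivDensities ν f g) (T : (ℕ → S) → ℕ∞) (A : ℝ)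
    (hT : ∀ x, ∀ n : ℕ, n < T x → logLR f g n x < A) :
    ∫⁻ x, (T x : ℝ≥0∞) ∂(streamLaw ν g) ≤
      ENNReal.ofReal (Real.exp (A / 2)) * (1 - affinity ν f g)⁻¹ := by
  have hm : ∀ n, MeasurableSet {x | logLR f g n x < A} := fun n =>
    obsSigma_le n _ (measurable_logLR h.left.measurable h.right.measurable le_rfl
      measurableSet_Iio)
  calc ∫⁻ x, (T x : ℝ≥0∞) ∂(streamLaw ν g)
      ≤ ∫⁻ x, ∑' n : ℕ, {x | logLR f g n x < A}.indicator 1 x ∂(streamLaw ν g) := by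
        refine lintegral_mono fun x => (toENNReal_le_tsum (T x)).trans
          (ENNReal.tsum_le_tsum (Set.indicator_le fun n hn => ?_))
        rw [Set.indicator_of_mem (show x ∈ {x | logLR f g n x < A} from hT x n hn)]
        rfl
    _ = ∑' n : ℕ, streamLaw ν g {x | logLR f g n x < A} := by
        rw [lintegral_tsum fun n => (measurable_one.indicator (hm n)).aemeasurable]
        exact tsum_congr fun n => lintegral_indicator_one (hm n)
    _ ≤ ∑' n : ℕ, ENNReal.ofReal (Real.exp (A / 2)) * affinity ν f g ^ n :=
        ENNReal.tsum_le_tsum fun n => streamLaw_logLR_lt_le h n A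
    _ = _ := by rw [ENNReal.tsum_mul_left, ENNReal.tsum_geometric]

theorem streamLaw_eq_zero_of_logLR_lt (h : AreEquivDensities ν f g) (A : ℝ) :
    streamLaw ν g {x | ∀ n, logLR f g n x < A} = 0 := by
  have hlim : Tendsto (fun n : ℕ => ENNReal.ofReal (Real.exp (A / 2)) * affinity ν f g ^ n)
      atTop (𝓝 0) := by
    simpa using ENNReal.Tendsto.const_mul
      (ENNReal.tendsto_pow_atTop_nhds_zero_of_lt_one h.affinity_lt_one)
      (Or.inr (ENNReal.ofReal_ne_top (r := Real.exp (A / 2))))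
  refine le_antisymm (ge_of_tendsto' hlim fun n => ?_) zero_le
  exact (measure_mono fun x (hx : ∀ n, logLR f g n x < A) => hx n).trans (streamLaw_logLR_lt_le h n A)

/-- Wald's inequality: on each of the disjoint events `T = n` with `Λ_n ≥ A`, the density `exp
(-Λ_n)` is at most `exp (-A)`, and their total `g`-probability is at most 1. -/
theorem streamLaw_stopped_logLR_ge_le (h : AreEquivDensities ν f g) (T : (ℕ → S) → ℕ∞)
    (hT : ∀ n : ℕ, 1 ≤ n → MeasurableSet[obsSigma S n] {x | T x = n}) (A : ℝ) :
    streamLaw ν f {x | ∃ n : ℕ, 1 ≤ n ∧ T x = n ∧ A ≤ logLR f g n x} ≤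
      ENNReal.ofReal (Real.exp (-A)) := by
  have := h.right.isProbabilityMeasure_streamLaw
  let E : ℕ → Set (ℕ → S) := fun n => {x | T x = (n + 1 : ℕ)} ∩ {x | A ≤ logLR f g (n + 1) x}
  have hE : ∀ n, MeasurableSet[obsSigma S (n + 1)] (E n) := fun n =>
    MeasurableSet.inter (hT (n + 1) n.succ_pos)
      (measurable_logLR h.left.measurable h.right.measurable le_rfl measurableSet_Ici)
  have hdisj : Pairwise (Function.onFun Disjoint E) := fun i j hij =>
    Set.disjoint_left.2 fun x hi hj => hij <| by
      have h1 : T x = (i + 1 : ℕ) := hi.1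
      rw [hj.1] at h1
      have := ENat.natCast_inj.1 h1
      omega
  calc streamLaw ν f {x | ∃ n : ℕ, 1 ≤ n ∧ T x = n ∧ A ≤ logLR f g n x}
      ≤ streamLaw ν f (⋃ n, E n) := by
        refine measure_mono ?_
        rintro x ⟨n, hn, hTn, hAn⟩
        obtain ⟨k, rfl⟩ := Nat.exists_eq_add_of_le' hn
        exact Set.mem_iUnion.2 ⟨k, hTn, hAn⟩
    _ ≤ ∑' n, streamLaw ν f (E n) := measure_iUnion_le _
    _ ≤ ∑' n, ENNReal.ofReal (Real.exp (-A)) * streamLaw ν g (E n) :=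
        ENNReal.tsum_le_tsum fun n => streamLaw_le_of_le_logLR h (n + 1) (hE n) fun x hx => hx.2
    _ = ENNReal.ofReal (Real.exp (-A)) * streamLaw ν g (⋃ n, E n) := by
        rw [ENNReal.tsum_mul_left, measure_iUnion hdisj fun n => obsSigma_le _ _ (hE n)]
    _ ≤ _ := mul_le_of_le_one_right' prob_le_one

end

end SharpSPRT


/-! ### The SPRT: paths, admissibility and mean sample sizes -/

namespace SharpSPRT

section

variable {S : Type*} (f g : S → ℝ) (A B : ℝ) (x : ℕ → S)

theorem logLR_swap (n : ℕ) : logLR g f n x = -logLR f g n x := by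
  unfold logLR
  rw [← Finset.sum_neg_distrib]
  refine Finset.sum_congr rfl fun i _ => ?_
  rw [← Real.log_inv, inv_div]

theorem sprtTime_swap : sprtTime g f B A x = sprtTime f g A B x := by
  have : {n : ℕ | 1 ≤ n ∧ logLR g f n x ∉ Set.Ioo (-A) B} =
      {n : ℕ | 1 ≤ n ∧ logLR f g n x ∉ Set.Ioo (-B) A} := by
    ext n
    simp only [Set.mem_ofPred_eq, logLR_swap f g x n, Set.mem_Ioo, neg_lt_neg_iff]
    rw [neg_lt (a := logLR f g n x), and_comm (a := logLR f g n x < A)]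
  unfold sprtTime
  rw [this]

theorem one_le_sprtTime : 1 ≤ sprtTime f g A B x :=
  le_iInf₂ fun n hn => by exact_mod_cast hn.1

variable {f g A B x}

theorem mem_Ioo_of_lt_sprtTime {n : ℕ} (hn : 1 ≤ n) (h : n < sprtTime f g A B x) :
    logLR f g n x ∈ Set.Ioo (-B) A := by
  by_contra hnot
  exact absurd h (not_lt.2 (iInf₂_le n ⟨hn, hnot⟩))

theorem logLR_lt_of_lt_sprtTime (hA : 0 < A) {n : ℕ} (h : n < sprtTime f g A B x) :
    logLR f g n x < A := by
  -- The stopping rule says nothing about time 0; there the sum is empty and `0 < A` is what is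
  -- needed.
  rcases Nat.eq_zero_or_pos n with rfl | hn
  · simpa [logLR] using hA
  · exact (mem_Ioo_of_lt_sprtTime hn h).2

theorem exists_sprtTime_eq (h : sprtTime f g A B x ≠ ⊤) :
    ∃ n : ℕ, 1 ≤ n ∧ sprtTime f g A B x = n ∧ logLR f g n x ∉ Set.Ioo (-B) A := by
  have hs : sprtTime f g A B x =
      sInf ((fun n : ℕ => (n : ℕ∞)) '' {n : ℕ | 1 ≤ n ∧ logLR f g n x ∉ Set.Ioo (-B) A}) := by
    rw [sInf_image]
    rfl
  have hne : ((fun n : ℕ => (n : ℕ∞)) ''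
      {n : ℕ | 1 ≤ n ∧ logLR f g n x ∉ Set.Ioo (-B) A}).Nonempty := by
    by_contra hempty
    rw [Set.not_nonempty_iff_eq_empty.1 hempty, sInf_empty] at hs
    exact h hs
  obtain ⟨n, hn, hneq⟩ := csInf_mem hne
  exact ⟨n, hn.1, hs.trans hneq.symm, hn.2⟩

theorem sprtTime_eq_iff {n : ℕ} (hn : 1 ≤ n) :
    sprtTime f g A B x = n ↔ logLR f g n x ∉ Set.Ioo (-B) A ∧
      ∀ k ∈ Finset.Ico 1 n, logLR f g k x ∈ Set.Ioo (-B) A := by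
  constructor
  · intro h
    obtain ⟨k, -, hkeq, hk⟩ := exists_sprtTime_eq (h.trans_ne (ENat.natCast_ne_top n))
    have : k = n := by exact_mod_cast hkeq.symm.trans h
    subst this
    refine ⟨hk, fun j hj => ?_⟩
    rw [Finset.mem_Ico] at hj
    refine mem_Ioo_of_lt_sprtTime hj.1 ?_
    rw [h]
    exact_mod_cast hj.2
  · rintro ⟨h, h'⟩
    refine le_antisymm (iInf₂_le n ⟨hn, h⟩) (le_iInf₂ fun k hk => ?_)
    by_contra hlt
    have hkn : k < n := by exact_mod_cast not_le.1 hlt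
    exact hk.2 (h' k (Finset.mem_Ico.2 ⟨hk.1, hkn⟩))

theorem sprtDecision_eq_true_iff :
    sprtDecision f g A B x = true ↔
      ∃ n : ℕ, 1 ≤ n ∧ sprtTime f g A B x = n ∧ A ≤ logLR f g n x := by
  unfold sprtDecision
  rw [decide_eq_true_iff]
  constructor
  · rintro ⟨h, h'⟩
    obtain ⟨n, hn, heq, -⟩ := exists_sprtTime_eq h
    rw [heq, ENat.toNat_natCast] at h'
    exact ⟨n, hn, heq, h'⟩
  · rintro ⟨n, -, heq, h⟩
    rw [heq, ENat.toNat_natCast]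
    exact ⟨ENat.natCast_ne_top n, h⟩

theorem le_neg_logLR_of_sprtDecision_eq_false (h : sprtDecision f g A B x = false)
    (hT : sprtTime f g A B x ≠ ⊤) :
    ∃ n : ℕ, 1 ≤ n ∧ sprtTime f g A B x = n ∧ logLR f g n x ≤ -B := by
  obtain ⟨n, hn, heq, hnot⟩ := exists_sprtTime_eq hT
  refine ⟨n, hn, heq, ?_⟩
  by_contra hB
  refine hnot ⟨not_le.1 hB, ?_⟩
  by_contra hA
  rw [sprtDecision_eq_true_iff.2 ⟨n, hn, heq, not_lt.1 hA⟩] at h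
  exact Bool.noConfusion h

end

section

variable {S : Type*} [MeasurableSpace S] {ν : Measure S} {f g : S → ℝ}

theorem measurableSet_sprtTime_eq (hf : Measurable f) (hg : Measurable g) (A B : ℝ) {n : ℕ}
    (hn : 1 ≤ n) : MeasurableSet[obsSigma S n] {x | sprtTime f g A B x = n} := by
  have hset : {x | sprtTime f g A B x = n} = {x | logLR f g n x ∈ (Set.Ioo (-B) A)ᶜ} ∩
      ⋂ k ∈ Finset.Ico 1 n, {x | logLR f g k x ∈ Set.Ioo (-B) A} := by
    ext x
    simp only [Set.mem_ofPred_eq, sprtTime_eq_iff hn, Set.mem_inter_iff, Set.mem_iInter,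
      Set.mem_compl_iff]
  rw [hset]
  refine MeasurableSet.inter (measurable_logLR hf hg le_rfl measurableSet_Ioo.compl)
    (Finset.measurableSet_biInter _ fun k hk => ?_)
  exact measurable_logLR hf hg (Finset.mem_Ico.1 hk).2.le measurableSet_Ioo

theorem isTest_sprt (hf : Measurable f) (hg : Measurable g) (α β : ℝ) :
    IsTest (sprt f g α β) := by
  set A := |Real.log α| with hA
  set B := |Real.log β| with hB
  have htrue : ∀ n : ℕ, 1 ≤ n → MeasurableSet[obsSigma S n]
      {x | sprtTime f g A B x = n ∧ sprtDecision f g A B x = true} := fun n hn => by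
    have hset : {x | sprtTime f g A B x = n ∧ sprtDecision f g A B x = true} =
        {x | sprtTime f g A B x = n} ∩ {x | logLR f g n x ∈ Set.Ici A} := by
      ext x
      simp only [Set.mem_ofPred_eq, Set.mem_inter_iff, sprtDecision_eq_true_iff, Set.mem_Ici]
      refine and_congr_right fun h => ⟨?_, fun h' => ⟨n, hn, h, h'⟩⟩
      rintro ⟨k, -, hk, hk'⟩
      have : k = n := by exact_mod_cast hk.symm.trans h
      rwa [← this]
    rw [hset]
    exact MeasurableSet.inter (measurableSet_sprtTime_eq hf hg A B hn)
      (measurable_logLR hf hg le_rfl measurableSet_Ici)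
  refine ⟨one_le_sprtTime f g A B, fun n hn => measurableSet_sprtTime_eq hf hg A B hn, ?_, ?_⟩
  · refine measurable_to_bool ?_
    have hset : (sprt f g α β).2 ⁻¹' {true} = ⋃ n : ℕ,
        {x | sprtTime f g A B x = (n + 1 : ℕ) ∧ sprtDecision f g A B x = true} := by
      ext x
      simp only [Set.mem_preimage, Set.mem_singleton_iff, Set.mem_iUnion, Set.mem_ofPred_eq,
        exists_and_right]
      refine ⟨fun h => ⟨?_, h⟩, fun h => h.2⟩
      obtain ⟨n, hn, heq, -⟩ := sprtDecision_eq_true_iff.1 h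
      exact ⟨n - 1, by rw [heq, Nat.sub_add_cancel hn]⟩
    rw [hset]
    exact MeasurableSet.iUnion fun n => obsSigma_le _ _ (htrue (n + 1) n.succ_pos)
  · intro n hn i
    cases i with
    | true => exact htrue n hn
    | false =>
      have hset : {x | (sprt f g α β).1 x = n ∧ (sprt f g α β).2 x = false} =
          {x | sprtTime f g A B x = n} \
            {x | sprtTime f g A B x = n ∧ sprtDecision f g A B x = true} := by
        ext x
        simp only [Set.mem_ofPred_eq, Set.mem_sdiff, not_and, Bool.not_eq_true]
        exact and_congr_right fun h => ⟨fun h' _ => h', fun h' => h' h⟩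
      rw [hset]
      exact MeasurableSet.diff (measurableSet_sprtTime_eq hf hg A B hn) (htrue n hn)

theorem abs_log_of_mem_Ioo {a : ℝ} (ha : a ∈ Set.Ioo (0 : ℝ) 1) :
    0 < |Real.log a| ∧ Real.exp (-|Real.log a|) = a := by
  have := Real.log_neg ha.1 ha.2
  refine ⟨abs_pos.2 this.ne, ?_⟩
  rw [abs_of_neg this, neg_neg, Real.exp_log ha.1]

/-- Wald's inequality in both directions. A path that never stops is assigned decision `false`, so
the type-II bound also needs such paths to be null under `g`. -/
theorem sprt_mem_testClass (h : AreEquivDensities ν f g) {α β : ℝ}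
    (hα : α ∈ Set.Ioo (0 : ℝ) 1) (hβ : β ∈ Set.Ioo (0 : ℝ) 1) :
    sprt f g α β ∈ testClass ν f g α β := by
  obtain ⟨hA, hexpA⟩ := abs_log_of_mem_Ioo hα
  obtain ⟨hB, hexpB⟩ := abs_log_of_mem_Ioo hβ
  refine ⟨isTest_sprt h.left.measurable h.right.measurable α β, ?_, ?_⟩
  · have := streamLaw_stopped_logLR_ge_le h (sprtTime f g |Real.log α| |Real.log β|)
      (fun n hn => measurableSet_sprtTime_eq h.left.measurable h.right.measurable _ _ hn)
      |Real.log α|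
    rw [hexpA] at this
    exact (measure_mono fun x hx => sprtDecision_eq_true_iff.1 hx).trans this
  · have hge := streamLaw_stopped_logLR_ge_le h.symm
      (sprtTime f g |Real.log α| |Real.log β|)
      (fun n hn => measurableSet_sprtTime_eq h.left.measurable h.right.measurable _ _ hn)
      |Real.log β|
    rw [hexpB] at hge
    have htop := streamLaw_eq_zero_of_logLR_lt h |Real.log α|
    have hsub : {x | (sprt f g α β).2 x = false} ⊆
        {x | ∀ n, logLR f g n x < |Real.log α|} ∪
        {x | ∃ n : ℕ, 1 ≤ n ∧ sprtTime f g |Real.log α| |Real.log β| x = n ∧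
          |Real.log β| ≤ logLR g f n x} := by
      intro x hx
      by_cases hT : sprtTime f g |Real.log α| |Real.log β| x = ⊤
      · refine Or.inl fun n => logLR_lt_of_lt_sprtTime (B := |Real.log β|) hA ?_
        rw [hT]
        exact ENat.natCast_lt_top n
      · obtain ⟨n, hn, heq, hle⟩ := le_neg_logLR_of_sprtDecision_eq_false hx hT
        exact Or.inr ⟨n, hn, heq, by rw [logLR_swap f g]; linarith⟩
    refine (measure_mono hsub).trans ((measure_union_le _ _).trans ?_)
    rw [htop, zero_add]
    exact hge

theorem exp_half_abs_log {a : ℝ} (ha : a ∈ Set.Ioo (0 : ℝ) 1) :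
    Real.exp (|Real.log a| / 2) = √(a⁻¹) := by
  rw [← Real.sqrt_sq (Real.exp_pos _).le, ← Real.exp_nat_mul, ← (abs_log_of_mem_Ioo ha).2,
    ← Real.exp_neg, neg_neg, (abs_log_of_mem_Ioo ha).2]
  congr 2
  push_cast
  ring

theorem meanTime_sprt_right_le (h : AreEquivDensities ν f g) {α : ℝ}
    (hα : α ∈ Set.Ioo (0 : ℝ) 1) (β : ℝ) :
    meanTime (streamLaw ν g) (sprt f g α β) ≤
      ENNReal.ofReal √(α⁻¹) * (1 - affinity ν f g)⁻¹ := by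
  rw [← exp_half_abs_log hα]
  exact lintegral_le_of_logLR_lt h _ _ fun x n hn =>
    logLR_lt_of_lt_sprtTime (abs_log_of_mem_Ioo hα).1 hn

theorem meanTime_sprt_left_le (h : AreEquivDensities ν f g) (α : ℝ) {β : ℝ}
    (hβ : β ∈ Set.Ioo (0 : ℝ) 1) :
    meanTime (streamLaw ν f) (sprt f g α β) ≤
      ENNReal.ofReal √(β⁻¹) * (1 - affinity ν g f)⁻¹ := by
  rw [← exp_half_abs_log hβ]
  refine lintegral_le_of_logLR_lt h.symm _ _ fun x n hn =>
    logLR_lt_of_lt_sprtTime (B := |Real.log α|) (abs_log_of_mem_Ioo hβ).1 ?_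
  rw [sprtTime_swap f g]
  exact hn

theorem one_le_meanTime (P : Measure (ℕ → S)) [IsProbabilityMeasure P] {τ : TimeDecision S}
    (hτ : IsTest τ) : 1 ≤ meanTime P τ := by
  rw [← measure_univ (μ := P), ← lintegral_one]
  refine lintegral_mono fun x => ?_
  simpa using ENat.toENNReal_le.2 (hτ.one_le x)

theorem meanTime_mixLaw (ν : Measure S) (f g : S → ℝ) (p : ℝ) (τ : TimeDecision S) :
    meanTime (mixLaw ν f g p) τ = ENNReal.ofReal (1 - p) * meanTime (streamLaw ν f) τ +
      ENNReal.ofReal p * meanTime (streamLaw ν g) τ := by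
  unfold meanTime mixLaw
  rw [lintegral_add_measure, lintegral_smul_measure, lintegral_smul_measure, smul_eq_mul,
    smul_eq_mul]

end

/-! ### Corrected levels and limit lemmas -/

theorem level_mem_Ioo {a d : ℝ} (ha : a ∈ Set.Ioo (0 : ℝ) 1) (hd : 0 < d) :
    1 - (1 - a) ^ (1 / d) ∈ Set.Ioo (0 : ℝ) 1 := by
  have h0 : 0 < 1 - a := by linarith [ha.2]
  have h1 := Real.rpow_pos_of_pos h0 (1 / d)
  have h2 := Real.rpow_lt_one h0.le (by linarith [ha.1]) (one_div_pos.2 hd)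
  constructor <;> linarith

theorem div_le_level {a d : ℝ} (ha : a ∈ Set.Ioo (0 : ℝ) 1) (hd : 1 ≤ d) :
    a / d ≤ 1 - (1 - a) ^ (1 / d) := by
  -- Bernoulli's inequality with exponent `1 / d ≤ 1`.
  have := rpow_one_add_le_one_add_mul_self (s := -a) (by linarith [ha.2])
    (p := 1 / d) (by positivity) (by rw [div_le_one (by linarith)]; exact hd)
  rw [← sub_eq_add_neg] at this
  have h2 : 1 / d * -a = -(a / d) := by ring
  linarith

theorem exists_level_eq {a d : ℝ} (ha : a ∈ Set.Ioo (0 : ℝ) 1) (hd : 0 < d) :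
    ∃ b ∈ Set.Ioo (0 : ℝ) 1, 1 - (1 - b) ^ (1 / d) = a := by
  have h0 : 0 < 1 - a := by linarith [ha.2]
  have h1 := Real.rpow_pos_of_pos h0 d
  have h2 := Real.rpow_lt_one h0.le (by linarith [ha.1]) hd
  refine ⟨1 - (1 - a) ^ d, ⟨by linarith, by linarith⟩, ?_⟩
  rw [sub_sub_cancel, one_div, Real.rpow_rpow_inv h0.le hd.ne', sub_sub_cancel]

/-- If the levels `a k` are at least `c / m k`, then `√(1 / a k)` is negligible with respect to
`m k`. -/
theorem tendsto_div_mul_sqrt_inv {c v : ℝ} (hc : 0 < c) (hv : 0 ≤ v) {a : ℕ → ℝ} {m : ℕ → ℕ}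
    (hm : Tendsto m atTop atTop) (hm1 : ∀ k, 1 ≤ m k) (ha : ∀ k, c / m k ≤ a k) {K : ℝ≥0∞}
    (hK : K ≠ ⊤) {z : ℕ → ℝ≥0∞} (hz : ∀ k, z k ≤ ENNReal.ofReal √((a k)⁻¹) * K) :
    Tendsto (fun k => ENNReal.ofReal (v / m k) * z k) atTop (𝓝 0) := by
  have hlim : Tendsto (fun k => ENNReal.ofReal (v * √(c⁻¹) / √(m k)) * K) atTop (𝓝 0) := by
    have h1 : Tendsto (fun k => v * √(c⁻¹) / √(m k : ℝ)) atTop (𝓝 0) :=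
      Tendsto.const_div_atTop
        (Real.tendsto_sqrt_atTop.comp (tendsto_natCast_atTop_atTop.comp hm)) _
    simpa using ENNReal.Tendsto.mul_const (ENNReal.tendsto_ofReal h1) (Or.inr hK)
  refine tendsto_of_tendsto_of_tendsto_of_le_of_le tendsto_const_nhds hlim
    (fun k => zero_le) fun k => ?_
  have hmpos : (0 : ℝ) < m k := by exact_mod_cast hm1 k
  refine (mul_le_mul_right (hz k) _).trans ?_
  rw [← mul_assoc, ← ENNReal.ofReal_mul (by positivity)]
  refine mul_le_mul_left (ENNReal.ofReal_le_ofReal ?_) _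
  have hle : √((a k)⁻¹) ≤ √(c⁻¹) * √(m k) := by
    rw [← Real.sqrt_mul (by positivity)]
    refine Real.sqrt_le_sqrt ?_
    rw [← div_eq_inv_mul, ← inv_div]
    exact inv_anti₀ (by positivity) (ha k)
  calc v / m k * √((a k)⁻¹) ≤ v / m k * (√(c⁻¹) * √(m k)) :=
        mul_le_mul_of_nonneg_left hle (by positivity)
    _ = v * √(c⁻¹) / √(m k) := by
        have hsq := Real.mul_self_sqrt hmpos.le
        have hs : 0 < √(m k : ℝ) := Real.sqrt_pos.2 hmpos
        rw [div_mul_eq_mul_div, div_eq_div_iff hmpos.ne' hs.ne']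
        linear_combination (v * √(c⁻¹)) * hsq

theorem asympLE_of_mix {x y e R a : ℕ → ℝ≥0∞} (hy : ∀ k, 1 ≤ y k)
    (hR : Tendsto R atTop (𝓝 1)) (ha : Tendsto a atTop (𝓝 1)) (he : Tendsto e atTop (𝓝 0))
    (h : ∀ᶠ k in atTop, a k * x k ≤ R k * (a k * y k + e k)) : AsympLE x y := by
  have hlim : Tendsto (fun k => R k * (1 + (a k)⁻¹ * e k)) atTop (𝓝 1) := by
    have h1 : Tendsto (fun k => (a k)⁻¹) atTop (𝓝 1) := by
      simpa using tendsto_inv_iff.2 ha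
    have h2 : Tendsto (fun k => (a k)⁻¹ * e k) atTop (𝓝 0) := by
      simpa using ENNReal.Tendsto.mul h1 (Or.inl one_ne_zero) he (Or.inr ENNReal.one_ne_top)
    have h3 : Tendsto (fun k => 1 + (a k)⁻¹ * e k) atTop (𝓝 1) := by
      simpa using tendsto_const_nhds.add h2
    simpa using ENNReal.Tendsto.mul hR (Or.inl one_ne_zero) h3 (Or.inl one_ne_zero)
  refine (limsup_le_limsup ?_).trans hlim.limsup_eq.le
  filter_upwards [h, ha.eventually_ne one_ne_zero, ha.eventually_ne ENNReal.one_ne_top]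
    with k hk ha0 hat
  refine ENNReal.div_le_of_le_mul ?_
  calc x k = (a k)⁻¹ * (a k * x k) := by
        rw [← mul_assoc, ENNReal.inv_mul_cancel ha0 hat, one_mul]
    _ ≤ (a k)⁻¹ * (R k * (a k * y k + e k)) := mul_le_mul_right hk _
    _ = R k * ((a k)⁻¹ * a k * y k + (a k)⁻¹ * e k) := by ring
    _ = R k * (y k + (a k)⁻¹ * e k * 1) := by
        rw [ENNReal.inv_mul_cancel ha0 hat, one_mul, mul_one]
    -- The bound `1 ≤ y k` turns the additive error into a multiplicative one.
    _ ≤ R k * (y k + (a k)⁻¹ * e k * y k) := by gcongr; exact hy k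
    _ = R k * (1 + (a k)⁻¹ * e k) * y k := by ring

/-- A sequence of natural numbers that does not tend to infinity is constant along a
subsequence. -/
theorem exists_strictMono_const_of_not_tendsto {w : ℕ → ℕ} (h : ¬ Tendsto w atTop atTop) :
    ∃ v, ∃ mk : ℕ → ℕ, StrictMono mk ∧ (∀ k, 1 ≤ mk k) ∧ ∀ k, w (mk k) = v := by
  rw [tendsto_atTop] at h
  push Not at h
  obtain ⟨b, hb⟩ := h
  -- Pigeonhole: infinitely often one of finitely many values is taken.
  have hfreq : ∃ᶠ m in atTop, ∃ v ∈ Finset.range b, w m = v :=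
    hb.mono fun m hm => ⟨w m, Finset.mem_range.2 hm, rfl⟩
  obtain ⟨v, -, hv⟩ := (Finset.frequently_exists _).1 hfreq
  obtain ⟨mk, hmk, hP⟩ :=
    extraction_of_frequently_atTop (hv.and_eventually (eventually_ge_atTop 1))
  exact ⟨v, mk, hmk, fun k => (hP k).2, fun k => (hP k).1⟩

/-! ### Comparison with the SPRT along the subsequence -/

section

variable {S : Type*} [MeasurableSpace S] {ν : Measure S} {f g : S → ℝ}

theorem meanTime_le_of_div_optTime_le (h : AreEquivDensities ν f g) {p α β : ℝ}
    (hp : p ∈ Set.Icc (0 : ℝ) 1)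
    (hα : α ∈ Set.Ioo (0 : ℝ) 1) (hβ : β ∈ Set.Ioo (0 : ℝ) 1) {E R : ℝ≥0∞}
    (hE : E / optTime ν f g p α β ≤ R) (hR : R ≠ 0) :
    E ≤ R * (ENNReal.ofReal (1 - p) * meanTime (streamLaw ν f) (sprt f g α β) +
      ENNReal.ofReal p * meanTime (streamLaw ν g) (sprt f g α β)) := by
  have := h.left.isProbabilityMeasure_streamLaw
  have := h.right.isProbabilityMeasure_streamLaw
  have hmem := sprt_mem_testClass h hα hβ
  have hopt : optTime ν f g p α β ≤ meanTime (mixLaw ν f g p) (sprt f g α β) :=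
    iInf₂_le _ hmem
  rw [← meanTime_mixLaw]
  -- Clearing the denominator in `ℝ≥0∞` needs a nonzero mean, in case `R = ⊤`, and `R ≠ 0`, in case
  -- the mean is `⊤`.
  have hne : meanTime (mixLaw ν f g p) (sprt f g α β) ≠ 0 := by
    have hprob : IsProbabilityMeasure (mixLaw ν f g p) := ⟨by
      rw [mixLaw, Measure.add_apply, Measure.smul_apply, Measure.smul_apply, measure_univ,
        measure_univ, smul_eq_mul, smul_eq_mul, mul_one, mul_one,
        ← ENNReal.ofReal_add (by linarith [hp.2]) hp.1, sub_add_cancel, ENNReal.ofReal_one]⟩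
    exact (zero_lt_one.trans_le (one_le_meanTime _ hmem.1)).ne'
  rw [← ENNReal.div_le_iff_le_mul (Or.inl hne) (Or.inr hR)]
  exact (ENNReal.div_le_div_left hopt _).trans hE

variable {l u : ℕ → ℕ} {χ : ℝ → ℝ → TimeDecision S}

theorem eventually_meanTime_le (h : AreEquivDensities ν f g)
    (hlu : ∀ m : ℕ, 1 ≤ m → l m ≤ u m ∧ u m ≤ m ∧ 0 < u m ∧ l m < m)
    (hopt : IsAsympOptimalHD ν f g l u χ) {α β : ℝ}
    (hα : α ∈ Set.Ioo (0 : ℝ) 1) (hβ : β ∈ Set.Ioo (0 : ℝ) 1) :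
    ∃ R : ℕ → ℝ≥0∞, Tendsto R atTop (𝓝 1) ∧ ∀ᶠ m : ℕ in atTop,
      ∀ s ∈ Finset.Icc (l m) (u m),
        ENNReal.ofReal (1 - s / m) *
            meanTime (streamLaw ν f) (χ (alphaLevel l α m) (betaLevel u β m)) +
          ENNReal.ofReal (s / m) *
            meanTime (streamLaw ν g) (χ (alphaLevel l α m) (betaLevel u β m)) ≤
        R m * (ENNReal.ofReal (1 - s / m) *
            meanTime (streamLaw ν f) (sprt f g (alphaLevel l α m) (betaLevel u β m)) +
          ENNReal.ofReal (s / m) *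
            meanTime (streamLaw ν g) (sprt f g (alphaLevel l α m) (betaLevel u β m))) := by
  -- `R m` is the supremum over `s` itself, so one sequence serves every `s`.
  refine ⟨_, hopt α hα β hβ, ?_⟩
  filter_upwards [eventually_ge_atTop 1,
    (hopt α hα β hβ).eventually_ne one_ne_zero] with m hm hR s hs
  obtain ⟨-, hum, hu, hl⟩ := hlu m hm
  have hm0 : (0 : ℝ) < m := by exact_mod_cast hm
  have hsm : (s : ℝ) ≤ m := by exact_mod_cast (Finset.mem_Icc.1 hs).2.trans hum
  have hd : (0 : ℝ) < (m : ℝ) - l m := sub_pos.2 (by exact_mod_cast hl)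
  refine meanTime_le_of_div_optTime_le h ⟨by positivity, (div_le_one hm0).2 hsm⟩
    (level_mem_Ioo hα hd) (level_mem_Ioo hβ (by exact_mod_cast hu)) ?_ hR
  rw [← meanTime_mixLaw]
  exact le_iSup₂ (f := fun s (_ : s ∈ Finset.Icc (l m) (u m)) =>
    meanTime (mixLaw ν f g ((s : ℝ) / (m : ℝ))) (χ (alphaLevel l α m) (betaLevel u β m)) /
      optTime ν f g ((s : ℝ) / (m : ℝ)) (alphaLevel l α m) (betaLevel u β m)) s hs

theorem AreEquivDensities.inv_one_sub_affinity_ne_top (h : AreEquivDensities ν f g) :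
    (1 - affinity ν f g)⁻¹ ≠ ⊤ :=
  ENNReal.inv_ne_top.2 (tsub_pos_of_lt h.affinity_lt_one).ne'

theorem tendsto_ofReal_one_sub_div {v : ℝ} {mk : ℕ → ℕ} (hmk : StrictMono mk) :
    Tendsto (fun k => ENNReal.ofReal (1 - v / mk k)) atTop (𝓝 1) := by
  have h0 : Tendsto (fun k => v / (mk k : ℝ)) atTop (𝓝 0) :=
    Tendsto.const_div_atTop (tendsto_natCast_atTop_atTop.comp hmk.tendsto_atTop) v
  simpa using ENNReal.tendsto_ofReal (tendsto_const_nhds (x := (1 : ℝ)) |>.sub h0)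

theorem asympLE_left_of_const (h : AreEquivDensities ν f g)
    (hlu : ∀ m : ℕ, 1 ≤ m → l m ≤ u m ∧ u m ≤ m ∧ 0 < u m ∧ l m < m)
    (hopt : IsAsympOptimalHD ν f g l u χ) {v : ℕ} {mk : ℕ → ℕ} (hmk : StrictMono mk)
    (hmk1 : ∀ k, 1 ≤ mk k) (hv : ∀ k, u (mk k) = v) {α β : ℝ}
    (hα : α ∈ Set.Ioo (0 : ℝ) 1) (hβ : β ∈ Set.Ioo (0 : ℝ) 1) :
    AsympLE (fun k => meanTime (streamLaw ν f) (χ (alphaLevel l α (mk k)) β))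
      (fun k => meanTime (streamLaw ν f) (sprt f g (alphaLevel l α (mk k)) β)) := by
  have := h.left.isProbabilityMeasure_streamLaw
  have hv0 : (0 : ℝ) < v := by
    rw [← hv 0]
    exact_mod_cast (hlu _ (hmk1 0)).2.2.1
  -- Optimality is applied at the level `b` whose correction for `v` is exactly `β`.
  obtain ⟨b, hb, hbβ⟩ := exists_level_eq hβ hv0
  have hlevel : ∀ k, betaLevel u b (mk k) = β := fun k => by rw [betaLevel, hv, hbβ]
  have hd : ∀ k, (1 : ℝ) ≤ (mk k : ℝ) - l (mk k) := fun k => by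
    have : ((l (mk k) + 1 : ℕ) : ℝ) ≤ mk k := by exact_mod_cast (hlu _ (hmk1 k)).2.2.2
    push_cast at this
    linarith
  obtain ⟨R, hR, hle⟩ := eventually_meanTime_le h hlu hopt hα hb
  refine asympLE_of_mix (a := fun k => ENNReal.ofReal (1 - v / mk k))
    (R := fun k => R (mk k)) (e := fun k => ENNReal.ofReal (v / mk k) *
      meanTime (streamLaw ν g) (sprt f g (alphaLevel l α (mk k)) β))
    (fun k => one_le_meanTime _ (isTest_sprt h.left.measurable h.right.measurable _ _))
    (hR.comp hmk.tendsto_atTop) (tendsto_ofReal_one_sub_div hmk)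
    (tendsto_div_mul_sqrt_inv hα.1 hv0.le hmk.tendsto_atTop hmk1 (fun k => ?_)
      h.inv_one_sub_affinity_ne_top
      fun k => meanTime_sprt_right_le h (level_mem_Ioo hα (by linarith [hd k])) β) ?_
  · refine le_trans ?_ (div_le_level hα (hd k))
    exact div_le_div_of_nonneg_left hα.1.le (by linarith [hd k])
      (sub_le_self _ (Nat.cast_nonneg _))
  · filter_upwards [hmk.tendsto_atTop.eventually hle] with k hk
    have := hk (u (mk k)) (Finset.mem_Icc.2 ⟨(hlu _ (hmk1 k)).1, le_rfl⟩)
    rw [hlevel, hv] at this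
    -- The `g`-term on the left is discarded.
    exact le_self_add.trans this

theorem asympLE_right_of_const (h : AreEquivDensities ν f g)
    (hlu : ∀ m : ℕ, 1 ≤ m → l m ≤ u m ∧ u m ≤ m ∧ 0 < u m ∧ l m < m)
    (hopt : IsAsympOptimalHD ν f g l u χ) {v : ℕ} {mk : ℕ → ℕ} (hmk : StrictMono mk)
    (hmk1 : ∀ k, 1 ≤ mk k) (hv : ∀ k, mk k - l (mk k) = v) {α β : ℝ}
    (hα : α ∈ Set.Ioo (0 : ℝ) 1) (hβ : β ∈ Set.Ioo (0 : ℝ) 1) :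
    AsympLE (fun k => meanTime (streamLaw ν g) (χ α (betaLevel u β (mk k))))
      (fun k => meanTime (streamLaw ν g) (sprt f g α (betaLevel u β (mk k)))) := by
  have := h.right.isProbabilityMeasure_streamLaw
  have hv0 : (0 : ℝ) < v := by
    rw [← hv 0]
    exact_mod_cast Nat.sub_pos_of_lt (hlu _ (hmk1 0)).2.2.2
  have hvr : ∀ k, (mk k : ℝ) - l (mk k) = v := fun k => by
    rw [← hv k, Nat.cast_sub (hlu _ (hmk1 k)).2.2.2.le]
  -- At `s = l m` the vanishing weight `v / m` falls on `f`.
  have hp : ∀ k, (l (mk k) : ℝ) / mk k = 1 - v / mk k := fun k => by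
    have : (mk k : ℝ) ≠ 0 := by exact_mod_cast Nat.one_le_iff_ne_zero.1 (hmk1 k)
    rw [← hvr k]
    field_simp
    ring
  obtain ⟨a, ha, haα⟩ := exists_level_eq hα hv0
  have hlevel : ∀ k, alphaLevel l a (mk k) = α := fun k => by rw [alphaLevel, hvr, haα]
  have hu : ∀ k, (1 : ℝ) ≤ u (mk k) := fun k => by exact_mod_cast (hlu _ (hmk1 k)).2.2.1
  obtain ⟨R, hR, hle⟩ := eventually_meanTime_le h hlu hopt ha hβ
  refine asympLE_of_mix (a := fun k => ENNReal.ofReal (1 - v / mk k))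
    (R := fun k => R (mk k)) (e := fun k => ENNReal.ofReal (v / mk k) *
      meanTime (streamLaw ν f) (sprt f g α (betaLevel u β (mk k))))
    (fun k => one_le_meanTime _ (isTest_sprt h.left.measurable h.right.measurable _ _))
    (hR.comp hmk.tendsto_atTop) (tendsto_ofReal_one_sub_div hmk)
    (tendsto_div_mul_sqrt_inv hβ.1 hv0.le hmk.tendsto_atTop hmk1 (fun k => ?_)
      h.symm.inv_one_sub_affinity_ne_top
      fun k => meanTime_sprt_left_le h α (level_mem_Ioo hβ (by linarith [hu k]))) ?_
  · refine le_trans ?_ (div_le_level hβ (hu k))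
    exact div_le_div_of_nonneg_left hβ.1.le (by linarith [hu k])
      (by exact_mod_cast (hlu _ (hmk1 k)).2.1)
  · filter_upwards [hmk.tendsto_atTop.eventually hle] with k hk
    have := hk (l (mk k)) (Finset.mem_Icc.2 ⟨le_rfl, (hlu _ (hmk1 k)).1⟩)
    rw [hlevel, hp, sub_sub_cancel] at this
    rw [add_comm (ENNReal.ofReal (1 - v / mk k) * _)]
    exact le_add_self.trans this

end

end SharpSPRT

theorem mainTheorem6 {S : Type*} [MeasurableSpace S] (ν : Measure S) [SigmaFinite ν]
    (f₀ f₁ : S → ℝ) (hf₀ : SharpSPRT.IsDensity ν f₀) (hf₁ : SharpSPRT.IsDensity ν f₁)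
    (hI₀ : SharpSPRT.klInfo ν f₀ f₁ ∈ Set.Ioo (0 : ℝ≥0∞) ⊤)
    (hI₁ : SharpSPRT.klInfo ν f₁ f₀ ∈ Set.Ioo (0 : ℝ≥0∞) ⊤)
    (l u : ℕ → ℕ)
    (hlu : ∀ m : ℕ, 1 ≤ m → l m ≤ u m ∧ u m ≤ m ∧ 0 < u m ∧ l m < m)
    (χ : ℝ → ℝ → SharpSPRT.TimeDecision S) (hχ : SharpSPRT.IsTestFamily ν f₀ f₁ χ)
    (hopt : SharpSPRT.IsAsympOptimalHD ν f₀ f₁ l u χ) :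
    (¬ Tendsto u atTop atTop →
      ∃ mk : ℕ → ℕ, StrictMono mk ∧ (∀ k, 1 ≤ mk k) ∧
        ∀ α ∈ Set.Ioo (0 : ℝ) 1, ∀ β ∈ Set.Ioo (0 : ℝ) 1,
          SharpSPRT.AsympLE
            (fun k => SharpSPRT.meanTime (SharpSPRT.streamLaw ν f₀)
              (χ (SharpSPRT.alphaLevel l α (mk k)) β))
            (fun k => SharpSPRT.meanTime (SharpSPRT.streamLaw ν f₀)
              (SharpSPRT.sprt f₀ f₁ (SharpSPRT.alphaLevel l α (mk k)) β))) ∧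
    (¬ Tendsto (fun m => m - l m) atTop atTop →
      ∃ mk : ℕ → ℕ, StrictMono mk ∧ (∀ k, 1 ≤ mk k) ∧
        ∀ α ∈ Set.Ioo (0 : ℝ) 1, ∀ β ∈ Set.Ioo (0 : ℝ) 1,
          SharpSPRT.AsympLE
            (fun k => SharpSPRT.meanTime (SharpSPRT.streamLaw ν f₁)
              (χ α (SharpSPRT.betaLevel u β (mk k))))
            (fun k => SharpSPRT.meanTime (SharpSPRT.streamLaw ν f₁)
              (SharpSPRT.sprt f₀ f₁ α (SharpSPRT.betaLevel u β (mk k))))) := by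
  have h := SharpSPRT.areEquivDensities_of_klInfo hf₀ hf₁ hI₀ hI₁
  refine ⟨fun hu => ?_, fun hl => ?_⟩
  -- The subsequence depends on `u` alone, so it serves all levels at once.
  · obtain ⟨v, mk, hmk, hmk1, hv⟩ := SharpSPRT.exists_strictMono_const_of_not_tendsto hu
    exact ⟨mk, hmk, hmk1, fun α hα β hβ =>
      SharpSPRT.asympLE_left_of_const h hlu hopt hmk hmk1 hv hα hβ⟩
  · obtain ⟨v, mk, hmk, hmk1, hv⟩ := SharpSPRT.exists_strictMono_const_of_not_tendsto hl
    exact ⟨mk, hmk, hmk1, fun α hα β hβ =>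
      SharpSPRT.asympLE_right_of_const h hlu hopt hmk hmk1 hv hα hβ⟩
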